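/- Let $K$ be a field, let $n\ge 3$, and let $\vec A_n$ be the linearly oriented quiver $1\to 2\to\cdots\to n$. Let $A=K\vec A_n/\mathcal I$ be a bound quiver algebra of $\vec A_n$, i.e. $\mathcal I$ is an admissible ideal of the path algebra $K\vec A_n$: a two-sided ideal with $R^m\subseteq \mathcal I\subseteq R^2$ for some $m\ge 2$, where $R$ is the two-sided ideal generated by the arrows. For an $A$-module $M$ and $k\in\mathbb N$, write $\operatorname{dom.dim} M\ge k$ if there is a minimal injective resolution $0\to M\to I_1\to I_2\to\cdots$ in which $I_1,\dots,I_k$ are all projective; let $\operatorname{dom.dim} M\in\mathbb N\cup\{\infty\}$ be the largest such $k$ ($0$ if $I_1$ is not projective, $\infty$ if there is no largest $k$), and let $\operatorname{dom.dim} A$ be the dominant dimension of the left regular module ${}_AA$. Then $$1\le \operatorname{dom.dim} A\le n-1 .$$ -/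

import Mathlib

universe u v w

noncomputable section

/-! ### Path algebras -/

/-- The set of all paths (including the trivial paths) of a quiver, each with its source and its
target. -/
abbrev QuiverPath (V : Type v) [Quiver.{w} V] : Type (max v w) :=
  Σ a : V, Σ b : V, Quiver.Path a b

/-- The path algebra `K Q` of a quiver `Q` with vertex set `V`: the `K`-vector space with basis the
paths of `Q`. -/
def PathAlgebra (K : Type u) (V : Type v) [CommRing K] [Quiver.{w} V] : Type (max u v w) :=
  QuiverPath V →₀ K

namespace PathAlgebra

variable {K : Type u} {V : Type v} [CommRing K] [Quiver.{w} V]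

instance : AddCommGroup (PathAlgebra K V) := inferInstanceAs (AddCommGroup (QuiverPath V →₀ K))

instance : Module K (PathAlgebra K V) := inferInstanceAs (Module K (QuiverPath V →₀ K))

variable (K) in
/-- The basis element of the path algebra given by a path. -/
def ofPath (p : QuiverPath V) : PathAlgebra K V := Finsupp.single p (1 : K)

variable (K) in
/-- The basis of the path algebra given by the paths. -/
def pathBasis : Module.Basis (QuiverPath V) K (PathAlgebra K V) := Finsupp.basisSingleOne

theorem pathBasis_apply (p : QuiverPath V) :
    pathBasis K p = ofPath K p := by
  exact congrFun (Finsupp.coe_basisSingleOne (R := K) (ι := QuiverPath V)) p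

/-- Induction principle: an additive and homogeneous property holds everywhere if it holds for
paths. -/
theorem induction_paths {P : PathAlgebra K V → Prop} (x : PathAlgebra K V) (h0 : P 0)
    (hadd : ∀ x y, P x → P y → P (x + y)) (hsmul : ∀ (r : K) x, P x → P (r • x))
    (hpath : ∀ a b (p : Quiver.Path a b), P (ofPath K ⟨a, b, p⟩)) : P x := by
  have hx : x ∈ Submodule.span K (Set.range (pathBasis K (V := V))) := by
    rw [(pathBasis K).span_eq]; trivial
  induction hx using Submodule.span_induction with
  | mem x hx =>
    obtain ⟨⟨a, b, p⟩, rfl⟩ := hx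
    rw [pathBasis_apply]; exact hpath a b p
  | zero => exact h0
  | add x y _ _ hx hy => exact hadd x y hx hy
  | smul r x _ hx => exact hsmul r x hx

/-- The unit of the path algebra of a quiver with finitely many vertices is the sum of the trivial
paths. -/
instance [Fintype V] : One (PathAlgebra K V) := ⟨∑ a : V, ofPath K ⟨a, a, Quiver.Path.nil⟩⟩

theorem one_def [Fintype V] : (1 : PathAlgebra K V) = ∑ a : V, ofPath K ⟨a, a, Quiver.Path.nil⟩ := rfl

variable [DecidableEq V]

variable (K) in
/-- The product of two paths: `p * q` is the path "first `q`, then `p`" if `q` ends where `p`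
starts, and zero otherwise. With this convention `A e_a` is spanned by the paths with source `a`. -/
def pathMul (p q : QuiverPath V) : PathAlgebra K V :=
  if h : q.2.1 = p.1 then ofPath K ⟨q.1, p.2.1, (q.2.2.cast rfl h).comp p.2.2⟩ else 0

/-- The multiplication of the path algebra, the bilinear extension of the product of paths. -/
def mulLin : PathAlgebra K V →ₗ[K] PathAlgebra K V →ₗ[K] PathAlgebra K V :=
  (pathBasis K).constr K fun p => (pathBasis K).constr K fun q => pathMul K p q

instance : Mul (PathAlgebra K V) := ⟨fun x y => mulLin x y⟩

theorem mul_def (x y : PathAlgebra K V) : x * y = mulLin x y := rfl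

theorem ofPath_mul_ofPath (p q : QuiverPath V) :
    ofPath K p * ofPath K q = pathMul K p q := by
  rw [mul_def, ← pathBasis_apply, ← pathBasis_apply, mulLin, Module.Basis.constr_basis,
    Module.Basis.constr_basis]

theorem ofPath_mul_ofPath_comp {a b c : V} (q : Quiver.Path a b) (p : Quiver.Path b c) :
    ofPath K ⟨b, c, p⟩ * ofPath K ⟨a, b, q⟩ = ofPath K ⟨a, c, q.comp p⟩ := by
  simp [ofPath_mul_ofPath, pathMul]

theorem ofPath_mul_ofPath_of_ne (p q : QuiverPath V) (h : q.2.1 ≠ p.1) :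
    ofPath K p * ofPath K q = 0 := by
  simp [ofPath_mul_ofPath, pathMul, h]

theorem mul_add' (x y z : PathAlgebra K V) : x * (y + z) = x * y + x * z := by
  simp [mul_def]

theorem add_mul' (x y z : PathAlgebra K V) : (x + y) * z = x * z + y * z := by
  simp [mul_def]

theorem zero_mul' (x : PathAlgebra K V) : 0 * x = 0 := by simp [mul_def]

theorem mul_zero' (x : PathAlgebra K V) : x * 0 = 0 := by simp [mul_def]

theorem smul_mul' (r : K) (x y : PathAlgebra K V) : (r • x) * y = r • (x * y) := by
  simp [mul_def]

theorem mul_smul' (r : K) (x y : PathAlgebra K V) : x * (r • y) = r • (x * y) := by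
  simp [mul_def]

theorem mul_assoc' (x y z : PathAlgebra K V) : x * y * z = x * (y * z) := by
  induction x using induction_paths with
  | h0 => simp [zero_mul']
  | hadd x x' hx hx' => simp [add_mul', hx, hx']
  | hsmul r x hx => simp [smul_mul', hx]
  | hpath c d p =>
  induction y using induction_paths with
  | h0 => simp [zero_mul', mul_zero']
  | hadd x x' hx hx' => simp [add_mul', mul_add', hx, hx']
  | hsmul r x hx => simp [smul_mul', mul_smul', hx]
  | hpath b c' q =>
  induction z using induction_paths with
  | h0 => simp [mul_zero']
  | hadd x x' hx hx' => simp [mul_add', hx, hx']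
  | hsmul r x hx => simp [mul_smul', hx]
  | hpath a b' r =>
  by_cases h : c' = c
  · subst h
    rw [ofPath_mul_ofPath_comp]
    by_cases h' : b' = b
    · subst h'
      simp only [ofPath_mul_ofPath_comp, Quiver.Path.comp_assoc]
    · rw [ofPath_mul_ofPath_of_ne _ _ h', ofPath_mul_ofPath_of_ne _ _ h', mul_zero']
  · rw [ofPath_mul_ofPath_of_ne _ _ h, zero_mul']
    by_cases h' : b' = b
    · subst h'
      rw [ofPath_mul_ofPath_comp, ofPath_mul_ofPath_of_ne _ _ h]
    · rw [ofPath_mul_ofPath_of_ne _ _ h', mul_zero']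

variable [Fintype V]

theorem one_mul' (x : PathAlgebra K V) : 1 * x = x := by
  induction x using induction_paths with
  | h0 => simp [mul_zero']
  | hadd x x' hx hx' => simp [mul_add', hx, hx']
  | hsmul r x hx => simp [mul_smul', hx]
  | hpath a b p =>
    rw [one_def, mul_def, map_sum, LinearMap.sum_apply, Finset.sum_eq_single b]
    · rw [← mul_def, ofPath_mul_ofPath_comp, Quiver.Path.comp_nil]
    · intro c _ hc
      rw [← mul_def, ofPath_mul_ofPath_of_ne _ _ hc.symm]
    · simp

theorem mul_one' (x : PathAlgebra K V) : x * 1 = x := by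
  induction x using induction_paths with
  | h0 => simp [zero_mul']
  | hadd x x' hx hx' => simp [add_mul', hx, hx']
  | hsmul r x hx => simp [smul_mul', hx]
  | hpath a b p =>
    rw [one_def, mul_def, map_sum, Finset.sum_eq_single a]
    · rw [← mul_def, ofPath_mul_ofPath_comp, Quiver.Path.nil_comp]
    · intro c _ hc
      rw [← mul_def, ofPath_mul_ofPath_of_ne _ _ hc]
    · simp

instance : Ring (PathAlgebra K V) :=
  { (inferInstance : AddCommGroup (PathAlgebra K V)),
    (inferInstance : Mul (PathAlgebra K V)),
    (inferInstance : One (PathAlgebra K V)) with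
    left_distrib := mul_add'
    right_distrib := add_mul'
    zero_mul := zero_mul'
    mul_zero := mul_zero'
    mul_assoc := mul_assoc'
    one_mul := one_mul'
    mul_one := mul_one' }

instance : Algebra K (PathAlgebra K V) := Algebra.ofModule smul_mul' mul_smul'

variable (K V) in
/-- The arrow ideal `R_Q`: the two-sided ideal of the path algebra generated by the arrows. -/
def arrowIdeal : Ideal (PathAlgebra K V) :=
  (TwoSidedIdeal.span
    {x : PathAlgebra K V | ∃ (a b : V) (α : a ⟶ b), x = ofPath K ⟨a, b, α.toPath⟩}).asIdeal

/-- An ideal `I` of the path algebra is admissible if it is two-sided and `R_Q ^ m ⊆ I ⊆ R_Q ^ 2`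
for some `m ≥ 2`. -/
structure IsAdmissible (I : Ideal (PathAlgebra K V)) : Prop where
  isTwoSided : I.IsTwoSided
  exists_pow_le : ∃ m : ℕ, 2 ≤ m ∧ arrowIdeal K V ^ m ≤ I
  le_sq : I ≤ arrowIdeal K V ^ 2

end PathAlgebra

/-! ### The linearly oriented quiver -/

/-- The vertex set of the linearly oriented quiver `1 ⟶ 2 ⟶ ⋯ ⟶ n` (vertices are numbered from
`0`). -/
def LinearQuiver (n : ℕ) : Type := Fin n

namespace LinearQuiver

instance (n : ℕ) : Fintype (LinearQuiver n) := inferInstanceAs (Fintype (Fin n))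

instance (n : ℕ) : DecidableEq (LinearQuiver n) := inferInstanceAs (DecidableEq (Fin n))

/-- The position of a vertex. -/
def pos {n : ℕ} (i : LinearQuiver n) : ℕ := Fin.val (n := n) i

/-- There is exactly one arrow `i ⟶ i + 1`, and there are no other arrows. -/
instance (n : ℕ) : Quiver.{0} (LinearQuiver n) := ⟨fun i j => PLift (pos i + 1 = pos j)⟩

end LinearQuiver

/-! ### Dominant dimension -/

/-- A submodule `N` of `M` is essential if it meets every nonzero submodule of `M` nontrivially. -/
def Submodule.IsEssential {A : Type u} {M : Type v} [Ring A] [AddCommGroup M] [Module A M]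
    (N : Submodule A M) : Prop :=
  ∀ L : Submodule A M, L ⊓ N = ⊥ → L = ⊥

/-- A minimal injective resolution `0 ⟶ M ⟶ I 0 ⟶ I 1 ⟶ I 2 ⟶ ⋯` of a (left) `A`-module `M`: an
exact sequence with injective modules `I j`, in which `I 0` is an injective envelope of `M` and
`I (j + 1)` is an injective envelope of the cokernel of the map into `I j`. -/
structure MinimalInjectiveResolution (A : Type u) (M : Type u) [Ring A] [AddCommGroup M]
    [Module A M] where
  /-- The terms. -/
  I : ℕ → ModuleCat.{u} A
  /-- The augmentation. -/
  ι : M →ₗ[A] I 0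
  /-- The differentials. -/
  d : ∀ j : ℕ, I j →ₗ[A] I (j + 1)
  injective : ∀ j, Module.Injective A (I j)
  ι_injective : Function.Injective ι
  exact_zero : Function.Exact ι (d 0)
  exact_succ : ∀ j, Function.Exact (d j) (d (j + 1))
  essential_zero : (LinearMap.range ι).IsEssential
  essential_succ : ∀ j, (LinearMap.range (d j)).IsEssential

/-- `M` has dominant dimension at least `n`: there is a minimal injective resolution of `M` whose
first `n` terms are projective (and injective). -/
def DomDimGE (A : Type u) (M : Type u) [Ring A] [AddCommGroup M] [Module A M] (n : ℕ) : Prop :=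
  ∃ R : MinimalInjectiveResolution A M, ∀ j < n, Module.Projective A (R.I j)

/-- The dominant dimension of an `A`-module `M`: the largest `n` such that `M` has dominant
dimension at least `n`, and `∞` if there is no largest such `n`. -/
def moduleDomDim (A : Type u) (M : Type u) [Ring A] [AddCommGroup M] [Module A M] : ℕ∞ :=
  ⨆ (n : ℕ) (_ : DomDimGE A M n), (n : ℕ∞)

/-- The dominant dimension of a ring `A`, that is, of the left regular module. -/
def domDim (A : Type u) [Ring A] : ℕ∞ := moduleDomDim A A

end

/-! The ideal is monomial: two vertices are joined by at most one path, so cutting an element down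
to e_j x e_i isolates a multiple of one path. Hence the nonzero residue classes of paths form a
basis of A, and admissibility keeps vertices and arrows nonzero. `LinearPathSystem` records this,
and both bounds follow from it.

Lower bound: if the path q → j is nonzero and cannot be prolonged at either end, A e_q is injective
as well as projective (`injective_proj`). Each vertex i lies on such a path; right multiplication by
the paths q → i embeds A in a product of these modules, and its injective envelope is a retract of
that product.

Upper bound: an essential extension cannot create support past the last supported vertex, and at
that vertex it adds nothing. So each cosyzygy loses at least one more vertex at the sink end, and `d
(n - 1)` vanishes (`e_smul_d_eq_zero`). If the first n terms were projective, the resolution would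
split back from there and A would be self-injective (`injective_of_d_eq_zero`); the last arrow,
which ends in a sink, rules this out (`not_injective`). -/

section EssentialExtensions

variable {A : Type u} [Ring A]

/-! ### Essential extensions inside an injective module -/

/-- A retract of an injective module is injective. -/
theorem Module.Injective.of_retract {E H : Type v} [AddCommGroup E] [AddCommGroup H] [Module A E]
    [Module A H] (hE : Module.Injective A E) (i : H →ₗ[A] E) (r : E →ₗ[A] H)
    (h : ∀ x, r (i x) = x) : Module.Injective A H where
  out X Y _ _ _ _ f hf g := by
    obtain ⟨k, hk⟩ := hE.out f hf (i ∘ₗ g)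
    exact ⟨r ∘ₗ k, fun x => by simp [hk, h]⟩

theorem Submodule.isEssential_iff {M : Type v} [AddCommGroup M] [Module A M] (N : Submodule A M) :
    N.IsEssential ↔ ∀ x : M, x ≠ 0 → ∃ a : A, a • x ∈ N ∧ a • x ≠ 0 := by
  constructor
  · intro h x hx
    by_contra! hcon
    refine hx (Submodule.span_singleton_eq_bot.mp (h (A ∙ x) ?_))
    rw [eq_bot_iff]
    rintro y ⟨hy, hyN⟩
    obtain ⟨a, rfl⟩ := Submodule.mem_span_singleton.mp hy
    exact hcon a hyN
  · intro h L hL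
    rw [eq_bot_iff]
    intro x hx
    by_contra hx0
    obtain ⟨a, ha, ha0⟩ := h x hx0
    have : a • x ∈ L ⊓ N := ⟨L.smul_mem a hx, ha⟩
    rw [hL] at this
    exact ha0 this

/-- A submodule of an injective module `E` has an essential extension inside `E` that is a retract
of `E`. -/
theorem Submodule.exists_essential_retract {E : Type v} [AddCommGroup E] [Module A E]
    (hE : Module.Injective A E) (N : Submodule A E) :
    ∃ (H : Submodule A E) (r : E →ₗ[A] H), N ≤ H ∧ (∀ x : H, r x = x) ∧
      ∀ x ∈ H, x ≠ 0 → ∃ a : A, a • x ∈ N ∧ a • x ≠ 0 := by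
  -- H is a maximal essential extension of N in E, and L below is a maximal submodule with L ∩ H =
  -- 0.
  obtain ⟨H, -, ⟨hNH, hH⟩, hHmax⟩ := zorn_le_nonempty₀
    {H : Submodule A E | N ≤ H ∧ ∀ x ∈ H, x ≠ 0 → ∃ a : A, a • x ∈ N ∧ a • x ≠ 0}
    (fun c hc hchain y hy => by
      refine ⟨sSup c, ⟨(hc hy).1.trans (le_sSup hy), fun x hx => ?_⟩, fun z hz => le_sSup hz⟩
      obtain ⟨z, hz, hxz⟩ := (Submodule.mem_sSup_of_directed ⟨y, hy⟩ hchain.directedOn).mp hx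
      exact (hc hz).2 x hxz) N
    ⟨le_rfl, fun x hx hx0 => ⟨1, by simpa using hx, by simpa using hx0⟩⟩
  obtain ⟨L, -, hL, hLmax⟩ := zorn_le_nonempty₀ {L : Submodule A E | ∀ x ∈ L, x ∈ H → x = 0}
    (fun c hc hchain y hy => by
      refine ⟨sSup c, fun x hx => ?_, fun z hz => le_sSup hz⟩
      obtain ⟨z, hz, hxz⟩ := (Submodule.mem_sSup_of_directed ⟨y, hy⟩ hchain.directedOn).mp hx
      exact hc hz x hxz) ⊥
    (fun x hx _ => hx)
  -- H embeds in E/L; injectivity of E extends the inclusion of H to g : E/L → E.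
  obtain ⟨g, hg⟩ := hE.out (L.mkQ ∘ₗ H.subtype) (by
    rw [← LinearMap.ker_eq_bot, eq_bot_iff]
    intro x hx
    have : (x : E) ∈ L := by simpa using hx
    exact Subtype.ext (hL _ this x.2)) H.subtype
  have hg' : ∀ h ∈ H, g (L.mkQ h) = h := fun h hh => hg ⟨h, hh⟩
  -- The range of g is essential over H: by maximality of L, the sum L + Ae meets H in some l + ae ≠
  -- 0, which g sends to itself.
  have key : ∀ e, g (L.mkQ e) ≠ 0 → ∃ a : A, a • g (L.mkQ e) ∈ H ∧ a • g (L.mkQ e) ≠ 0 := by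
    intro e he
    have heL : e ∉ L := fun h =>
      he ((congrArg g ((Submodule.Quotient.mk_eq_zero L).mpr h)).trans g.map_zero)
    have : ¬ ∀ x ∈ L ⊔ A ∙ e, x ∈ H → x = 0 := fun h =>
      heL (hLmax h le_sup_left (Submodule.mem_sup_right (Submodule.mem_span_singleton_self e)))
    push Not at this
    obtain ⟨x, hx, hxH, hx0⟩ := this
    obtain ⟨l, hl, y, hy, rfl⟩ := Submodule.mem_sup.mp hx
    obtain ⟨a, rfl⟩ := Submodule.mem_span_singleton.mp hy
    have hl0 : L.mkQ l = 0 := (Submodule.Quotient.mk_eq_zero L).mpr hl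
    have := hg' _ hxH
    rw [map_add, hl0, zero_add, map_smul, map_smul] at this
    exact ⟨a, by rwa [this], by rwa [this]⟩
  -- Essentiality is transitive, so maximality of H applies to the range of g.
  have hrange : LinearMap.range g ≤ H := by
    refine hHmax ⟨fun x hx => ⟨L.mkQ x, hg' x (hNH hx)⟩, ?_⟩ fun x hx => ⟨L.mkQ x, hg' x hx⟩
    rintro _ ⟨q, rfl⟩ hq
    obtain ⟨e, rfl⟩ := L.mkQ_surjective q
    obtain ⟨a, ha, ha0⟩ := key e hq
    obtain ⟨b, hb, hb0⟩ := hH _ ha ha0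
    exact ⟨b * a, by rwa [mul_smul], by rwa [mul_smul]⟩
  refine ⟨H, (g ∘ₗ L.mkQ).codRestrict H fun e => hrange ⟨_, rfl⟩, hNH, fun x => ?_, hH⟩
  exact Subtype.ext (hg' x x.2)

/-! ### Injective envelopes and minimal injective resolutions -/

/-- An injective envelope of a module. -/
structure InjectiveEnvelope (A : Type u) [Ring A] (M : ModuleCat.{u} A) where
  /-- The injective module. -/
  E : ModuleCat.{u} A
  /-- The embedding. -/
  ι : M →ₗ[A] E
  injective : Module.Injective A E
  ι_injective : Function.Injective ι
  essential : (LinearMap.range ι).IsEssential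

/-- A module that embeds in an injective module `E` has an injective envelope that is a retract of
`E`. -/
theorem InjectiveEnvelope.exists_retract (M E : ModuleCat.{u} A) (hE : Module.Injective A E)
    (f : M →ₗ[A] E) (hf : Function.Injective f) :
    ∃ (H : InjectiveEnvelope A M) (i : H.E →ₗ[A] E) (r : E →ₗ[A] H.E), ∀ x, r (i x) = x := by
  obtain ⟨H, r, hN, hr, hH⟩ := (LinearMap.range f).exists_essential_retract hE
  refine ⟨⟨ModuleCat.of A H, f.codRestrict H fun x => hN ⟨x, rfl⟩,
    hE.of_retract H.subtype r hr, fun x y h => hf (congrArg Subtype.val h), ?_⟩, H.subtype, r, hr⟩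
  rw [Submodule.isEssential_iff]
  intro (x : H) hx
  obtain ⟨a, ⟨y, hy⟩, ha0⟩ := hH x x.2 (fun h => hx (Subtype.ext h))
  exact ⟨a, ⟨y, Subtype.ext hy⟩, fun h => ha0 (congrArg Subtype.val h)⟩

theorem InjectiveEnvelope.nonempty (M : ModuleCat.{u} A) : Nonempty (InjectiveEnvelope A M) := by
  obtain ⟨P⟩ := CategoryTheory.EnoughInjectives.presentation M
  have : CategoryTheory.Injective (ModuleCat.of A P.J) := P.injective
  have hinj : Module.Injective A P.J := Module.injective_module_of_injective_object A P.J
  obtain ⟨H, -⟩ := exists_retract M P.J hinj P.f.hom ((ModuleCat.mono_iff_injective P.f).mp P.mono)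
  exact ⟨H⟩

/-- The cosyzygies of `M` with their injective envelopes, starting from a given envelope of `M`. -/
noncomputable def InjectiveEnvelope.cosyzygy {M : ModuleCat.{u} A} (H : InjectiveEnvelope A M) :
    ℕ → Σ N : ModuleCat.{u} A, InjectiveEnvelope A N
  | 0 => ⟨M, H⟩
  | k + 1 => ⟨ModuleCat.of A ((H.cosyzygy k).2.E ⧸ LinearMap.range (H.cosyzygy k).2.ι),
      (InjectiveEnvelope.nonempty _).some⟩

/-- The projection from an injective envelope of a cosyzygy onto the next cosyzygy. -/
noncomputable def InjectiveEnvelope.toCosyzygy {M : ModuleCat.{u} A} (H : InjectiveEnvelope A M)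
    (k : ℕ) : (H.cosyzygy k).2.E →ₗ[A] (H.cosyzygy (k + 1)).1 :=
  (LinearMap.range (H.cosyzygy k).2.ι).mkQ

theorem InjectiveEnvelope.exact_toCosyzygy {M : ModuleCat.{u} A} (H : InjectiveEnvelope A M)
    (k : ℕ) : Function.Exact (H.cosyzygy k).2.ι (H.toCosyzygy k) :=
  LinearMap.exact_iff.mpr (Submodule.ker_mkQ _)

theorem InjectiveEnvelope.toCosyzygy_surjective {M : ModuleCat.{u} A} (H : InjectiveEnvelope A M)
    (k : ℕ) : Function.Surjective (H.toCosyzygy k) :=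
  Submodule.mkQ_surjective _

/-- The minimal injective resolution that starts with a given injective envelope. -/
noncomputable def InjectiveEnvelope.resolution {M : ModuleCat.{u} A} (H : InjectiveEnvelope A M) :
    MinimalInjectiveResolution A M where
  I k := (H.cosyzygy k).2.E
  ι := H.ι
  d k := (H.cosyzygy (k + 1)).2.ι ∘ₗ H.toCosyzygy k
  injective k := (H.cosyzygy k).2.injective
  ι_injective := H.ι_injective
  exact_zero x := by
    refine Iff.trans ?_ (H.exact_toCosyzygy 0 x)
    exact map_eq_zero_iff _ (H.cosyzygy 1).2.ι_injective
  exact_succ j x := by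
    rw [LinearMap.coe_comp (H.cosyzygy (j + 1)).2.ι, Set.range_comp,
      (H.toCosyzygy_surjective j).range_eq, Set.image_univ]
    refine Iff.trans ?_ (H.exact_toCosyzygy (j + 1) x)
    exact map_eq_zero_iff _ (H.cosyzygy (j + 1 + 1)).2.ι_injective
  essential_zero := H.essential
  essential_succ j := by
    rw [LinearMap.range_comp_of_range_eq_top _
      (LinearMap.range_eq_top.mpr (H.toCosyzygy_surjective j))]
    exact (H.cosyzygy (j + 1)).2.essential

/-- The envelope of M is a retract of E, hence projective; the resolution may continue arbitrarily.
-/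
theorem domDimGE_one_of_embedding (M E : ModuleCat.{u} A) (hE : Module.Injective A E)
    (hP : Module.Projective A E) (f : M →ₗ[A] E) (hf : Function.Injective f) :
    DomDimGE A M 1 := by
  obtain ⟨H, i, r, hr⟩ := InjectiveEnvelope.exists_retract M E hE f hf
  refine ⟨H.resolution, fun j hj => ?_⟩
  obtain rfl : j = 0 := by omega
  exact Module.Projective.of_split i r (LinearMap.ext hr)

/-! ### Splitting a resolution back from a vanishing differential -/

/-- A surjection onto a projective module with essential kernel is zero. -/
theorem eq_zero_of_projective_of_essential {M P : Type*} [AddCommGroup M] [Module A M]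
    [AddCommGroup P] [Module A P] [Module.Projective A P] (f : M →ₗ[A] P)
    (hf : Function.Surjective f) (hess : (LinearMap.ker f).IsEssential) : f = 0 := by
  obtain ⟨s, hs⟩ := f.exists_rightInverse_of_surjective (LinearMap.range_eq_top.mpr hf)
  have hs' : ∀ x, f (s x) = x := fun x => LinearMap.congr_fun hs x
  -- The image of a section meets the kernel trivially.
  have : LinearMap.range s = ⊥ := hess _ (by
    rw [eq_bot_iff]
    rintro _ ⟨⟨y, rfl⟩, hy⟩
    have : y = 0 := by rw [← hs' y]; exact hy
    simp [this])
  ext x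
  rw [LinearMap.range_eq_bot] at this
  rw [← hs' (f x), this]
  simp

/-- If the first `n` terms of a minimal injective resolution are projective and the `n`-th
cosyzygy vanishes, then the resolved module is injective. -/
theorem MinimalInjectiveResolution.injective_of_d_eq_zero {M : Type u} [AddCommGroup M] [Module A M]
    (R : MinimalInjectiveResolution A M) (n : ℕ) (hproj : ∀ j < n + 1, Module.Projective A (R.I j))
    (hd : R.d n = 0) : Module.Injective A M := by
  induction n with
  | zero =>
    have hsurj : Function.Surjective R.ι := fun x => (R.exact_zero x).mp (by simp [hd])
    let e := LinearEquiv.ofBijective R.ι ⟨R.ι_injective, hsurj⟩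
    exact (R.injective 0).of_retract e.toLinearMap e.symm.toLinearMap (by simp)
  | succ n ih =>
    refine ih (fun j hj => hproj j (by omega)) ?_
    -- As `d (n + 1) = 0`, exactness makes `d n` surjective onto a projective module; its kernel is
    -- the image of the preceding map, hence essential.
    have := hproj (n + 1) (by omega)
    refine eq_zero_of_projective_of_essential _ (fun x => (R.exact_succ n x).mp (by simp [hd])) ?_
    cases n with
    | zero => rw [LinearMap.exact_iff.mp R.exact_zero]; exact R.essential_zero
    | succ n => rw [LinearMap.exact_iff.mp (R.exact_succ n)]; exact R.essential_succ n

end EssentialExtensions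

/-! ### Algebras with a basis of paths -/

/-- A `K`-algebra spanned by the paths `i ⟶ j` of the linearly oriented quiver with `n` vertices,
in which the nonzero paths are linearly independent. -/
structure LinearPathSystem (K : Type v) (A : Type u) [Field K] [Ring A] [Algebra K A] (n : ℕ) where
  /-- The path from `i` to `j`, or zero if there is none. -/
  e : Fin n → Fin n → A
  /-- The coefficient of the path from `i` to `j`. -/
  coef : Fin n → Fin n → A →ₗ[K] K
  sum_coef : ∀ x, ∑ i, ∑ j, coef i j x • e i j = x
  one_eq : 1 = ∑ i, e i i
  e_mul_e : ∀ {i j k}, i ≤ j → j ≤ k → e j k * e i j = e i k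
  e_mul_e_of_ne : ∀ {i j j' k}, j ≠ j' → e j' k * e i j = 0
  e_eq_zero : ∀ {i j}, j < i → e i j = 0
  coef_e_self : ∀ {i j}, e i j ≠ 0 → coef i j (e i j) = 1
  coef_e_of_ne : ∀ {i j k l}, (k, l) ≠ (i, j) → coef i j (e k l) = 0

namespace LinearPathSystem

variable {K : Type v} {A : Type u} [Field K] [Ring A] [Algebra K A] {n : ℕ}
  (S : LinearPathSystem K A n)

include S

theorem le_of_e_ne_zero {i j : Fin n} (h : S.e i j ≠ 0) : i ≤ j :=
  not_lt.mp fun hlt => h (S.e_eq_zero hlt)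

theorem e_ne_zero_of_le {i j k : Fin n} (hij : i ≤ j) (hjk : j ≤ k) (h : S.e i k ≠ 0) :
    S.e i j ≠ 0 := fun h0 => h (by rw [← S.e_mul_e hij hjk, h0, mul_zero])

theorem linearMap_ext {M : Type*} [AddCommGroup M] [Module K M] {f g : A →ₗ[K] M}
    (h : ∀ i j, S.e i j ≠ 0 → f (S.e i j) = g (S.e i j)) : f = g := by
  ext x
  rw [← S.sum_coef x]
  simp only [map_sum, map_smul]
  refine Finset.sum_congr rfl fun i _ => Finset.sum_congr rfl fun j _ => ?_
  by_cases h0 : S.e i j = 0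
  · simp [h0]
  · rw [h i j h0]

/-- Right multiplication by a path. -/
theorem mul_e {q i : Fin n} (hqi : q ≤ i) (x : A) :
    x * S.e q i = ∑ k, S.coef i k x • S.e q k := by
  have : LinearMap.mulRight K (S.e q i) = ∑ k, (S.coef i k).smulRight (S.e q k) := by
    refine S.linearMap_ext fun s t hst => ?_
    simp only [LinearMap.mulRight_apply, LinearMap.sum_apply, LinearMap.smulRight_apply]
    by_cases hs : i = s
    · subst hs
      rw [S.e_mul_e hqi (S.le_of_e_ne_zero hst), Finset.sum_eq_single t,
        S.coef_e_self hst, one_smul]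
      · intro k _ hk
        rw [S.coef_e_of_ne (by simp [hk.symm]), zero_smul]
      · simp
    · rw [S.e_mul_e_of_ne hs, Finset.sum_eq_zero]
      intro k _
      rw [S.coef_e_of_ne (by simp [Ne.symm hs]), zero_smul]
  simpa using LinearMap.congr_fun this x

/-- The coefficients of `x` at a path `q ⟶ k` that is part of a nonzero path `q ⟶ j`. -/
theorem coef_e_mul {q k j : Fin n} (hkj : k ≤ j) (hqj : S.e q j ≠ 0) (x : A) :
    S.coef q j (S.e k j * x) = S.coef q k x := by
  have : S.coef q j ∘ₗ LinearMap.mulLeft K (S.e k j) = S.coef q k := by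
    refine S.linearMap_ext fun s t hst => ?_
    simp only [LinearMap.comp_apply, LinearMap.mulLeft_apply]
    by_cases ht : t = k
    · subst ht
      rw [S.e_mul_e (S.le_of_e_ne_zero hst) hkj]
      by_cases hs : s = q
      · subst hs
        rw [S.coef_e_self hqj, S.coef_e_self hst]
      · rw [S.coef_e_of_ne (by simp [hs]), S.coef_e_of_ne (by simp [hs])]
    · rw [S.e_mul_e_of_ne ht, map_zero, S.coef_e_of_ne (by simp [ht])]
  exact LinearMap.congr_fun this x

/-- Left multiplication by `e a b` keeps only paths ending at a, and these start no later than a. -/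
theorem coef_e_mul_of_lt {s a b : Fin n} (hab : a < s) (y : A) :
    S.coef s b (S.e a b * y) = 0 := by
  have : S.coef s b ∘ₗ LinearMap.mulLeft K (S.e a b) = 0 := by
    refine S.linearMap_ext fun s' t hst => ?_
    simp only [LinearMap.comp_apply, LinearMap.mulLeft_apply, LinearMap.zero_apply]
    by_cases ht : t = a
    · subst ht
      rcases le_or_gt t b with htb | htb
      · have := S.le_of_e_ne_zero hst
        rw [S.e_mul_e this htb, S.coef_e_of_ne]
        intro h
        simp only [Prod.mk.injEq, and_true] at h
        omega
      · rw [S.e_eq_zero htb, zero_mul, map_zero]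
    · rw [S.e_mul_e_of_ne ht, map_zero]
  exact LinearMap.congr_fun this y

/-! ### Projective-injective modules and the lower bound -/

/-- The left ideal `A e_i` of the elements fixed by right multiplication by the trivial path at
`i`. -/
def proj (i : Fin n) : Submodule A A :=
  LinearMap.eqLocus (LinearMap.toSpanSingleton A A (S.e i i)) .id

theorem mem_proj {i : Fin n} {x : A} : x ∈ S.proj i ↔ x * S.e i i = x := Iff.rfl

theorem e_mem_proj (i j : Fin n) : S.e i j ∈ S.proj i := by
  rw [mem_proj]
  rcases le_or_gt i j with h | h
  · exact S.e_mul_e le_rfl h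
  · rw [S.e_eq_zero h, zero_mul]

theorem mul_e_mem_proj (x : A) (q i : Fin n) : x * S.e q i ∈ S.proj q :=
  (S.proj q).smul_mem x (S.e_mem_proj q i)

theorem eq_sum_of_mem_proj {i : Fin n} {x : A} (hx : x ∈ S.proj i) :
    x = ∑ k, S.coef i k x • S.e i k := by
  rw [← S.mul_e le_rfl, S.mem_proj.mp hx]

theorem projective_proj (i : Fin n) : Module.Projective A (S.proj i) :=
  Module.Projective.of_split (S.proj i).subtype
    ((LinearMap.toSpanSingleton A A (S.e i i)).codRestrict (S.proj i)
      fun x => S.mul_e_mem_proj x i i)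
    (LinearMap.ext fun x => Subtype.ext x.2)

theorem smul_mem_proj {i : Fin n} (c : K) {x : A} (hx : x ∈ S.proj i) : c • x ∈ S.proj i := by
  rw [mem_proj, smul_mul_assoc, S.mem_proj.mp hx]

/-- If the nonzero path `q ⟶ j` is maximal, then `A e_q` is injective. -/
theorem injective_proj {q j : Fin n} (hqj : S.e q j ≠ 0) (hq : ∀ q' < q, S.e q' j = 0)
    (hj : ∀ j' > j, S.e q j' = 0) : Module.Injective A (S.proj q) := by
  -- The coefficient at q → j is a nondegenerate form on A e_q, so a map into A e_q is determined by
  -- a K-linear functional, which can be extended from L to A.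
  have nondeg : ∀ z ∈ S.proj q, (∀ y, S.coef q j (y * z) = 0) → z = 0 := by
    intro z hz h
    rw [S.eq_sum_of_mem_proj hz]
    refine Finset.sum_eq_zero fun k _ => ?_
    rcases le_or_gt k j with hk | hk
    · rw [← S.coef_e_mul hk hqj, h, zero_smul]
    · rw [hj k hk, smul_zero]
  refine Module.Baer.injective fun L f => ?_
  let ψ : L.restrictScalars K →ₗ[K] K :=
    S.coef q j ∘ₗ ((S.proj q).subtype ∘ₗ f).restrictScalars K
  obtain ⟨ψ', hψ⟩ := LinearMap.exists_extend ψ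
  have hψ' : ∀ l : L, ψ' l = S.coef q j (f l) := fun l => LinearMap.congr_fun hψ l
  -- The element representing y ↦ ψ'(e_j y) through this form; no path into j starts before q, so
  -- `key` holds on all of A.
  let a : A := ∑ k, ψ' (S.e k j) • S.e q k
  have ha : a ∈ S.proj q :=
    Submodule.sum_mem _ fun k _ => S.smul_mem_proj _ (S.e_mem_proj q k)
  have key : ∀ y, S.coef q j (y * a) = ψ' (S.e j j * y) := by
    intro y
    have : S.coef q j ∘ₗ LinearMap.mulRight K a = ψ' ∘ₗ LinearMap.mulLeft K (S.e j j) := by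
      refine S.linearMap_ext fun s t hst => ?_
      have hst' := S.le_of_e_ne_zero hst
      simp only [LinearMap.comp_apply, LinearMap.mulLeft_apply, LinearMap.mulRight_apply, a,
        Finset.mul_sum, mul_smul_comm, map_sum, map_smul]
      rw [Finset.sum_eq_single s]
      · by_cases ht : t = j
        · subst ht
          rw [S.e_mul_e hst' le_rfl]
          rcases le_or_gt q s with hqs | hqs
          · rw [S.e_mul_e hqs hst', S.coef_e_self hqj, smul_eq_mul, mul_one]
          · rw [hq s hqs, map_zero, zero_smul]
        · rw [S.e_mul_e_of_ne ht, map_zero]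
          rcases le_or_gt q s with hqs | hqs
          · rw [S.e_mul_e hqs hst', S.coef_e_of_ne (by simp [ht]), smul_zero]
          · rw [S.e_eq_zero hqs, mul_zero, map_zero, smul_zero]
      · intro k _ hk
        rw [S.e_mul_e_of_ne hk, map_zero, smul_zero]
      · simp
    exact LinearMap.congr_fun this y
  refine ⟨LinearMap.toSpanSingleton A _ ⟨a, ha⟩, fun l hl => Subtype.ext ?_⟩
  refine (sub_eq_zero.mp (nondeg _ (sub_mem (f ⟨l, hl⟩).2 ((S.proj q).smul_mem l ha)) ?_)).symm
  intro y
  have h1 : y * (f ⟨l, hl⟩ : A) = f (y • ⟨l, hl⟩) := by rw [map_smul]; rfl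
  have h2 : S.coef q j (f (y • ⟨l, hl⟩)) = ψ' (S.e j j * (y * l)) := by
    rw [← S.coef_e_mul le_rfl hqj]
    have : S.e j j * (f (y • ⟨l, hl⟩) : A) = f (S.e j j • y • ⟨l, hl⟩) := by
      rw [map_smul f (S.e j j)]; rfl
    rw [this, ← hψ']
    rfl
  rw [mul_sub, map_sub, h1, h2, smul_eq_mul, ← mul_assoc y, key, sub_self]

/-- Every nonzero trivial path is part of a maximal nonzero path. -/
theorem exists_maximal_path {i : Fin n} (hi : S.e i i ≠ 0) : ∃ q j : Fin n, q ≤ i ∧ S.e q j ≠ 0 ∧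
    (∀ q' < q, S.e q' j = 0) ∧ (∀ j' > j, S.e q j' = 0) ∧ ∀ j' > j, S.e i j' = 0 := by
  classical
  -- Prolong from i forwards to j, then from j backwards to q. A nonzero q → j' with j' > j would
  -- contain a nonzero i → j'.
  obtain ⟨j, hj, hjmax⟩ := Finset.exists_maximal (s := Finset.univ.filter fun j => S.e i j ≠ 0)
    ⟨i, by simpa using hi⟩
  obtain ⟨q, hq, hqmin⟩ := Finset.exists_minimal (s := Finset.univ.filter fun q => S.e q j ≠ 0)
    ⟨i, by simpa using (Finset.mem_filter.mp hj).2⟩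
  simp only [Finset.mem_filter, Finset.mem_univ, true_and] at hj hjmax hq hqmin
  have hqi : q ≤ i := by
    by_contra! h
    exact absurd (hqmin hj h.le) (not_le.mpr h)
  have hj' : ∀ j' > j, S.e i j' = 0 := fun j' h => by
    by_contra h0
    exact absurd (hjmax h0 h.le) (not_le.mpr h)
  refine ⟨q, j, hqi, hq, fun q' h => ?_, fun j' h => ?_, hj'⟩
  · by_contra h0
    exact absurd (hqmin h0 h.le) (not_le.mpr h)
  · rw [← S.e_mul_e hqi ((S.le_of_e_ne_zero hj).trans h.le), hj' j' h, zero_mul]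

theorem domDimGE_one (h : ∀ i, S.e i i ≠ 0) : DomDimGE A A 1 := by
  choose q j hqi hqj hq hj hij using fun i => S.exists_maximal_path (h i)
  have (i : Fin n) := S.projective_proj (q i)
  have (i : Fin n) := S.injective_proj (hqj i) (hq i) (hj i)
  let f : A →ₗ[A] (i : Fin n) → S.proj (q i) := LinearMap.pi fun i =>
    (LinearMap.toSpanSingleton A A (S.e (q i) i)).codRestrict (S.proj (q i))
      fun x => S.mul_e_mem_proj x (q i) i
  refine domDimGE_one_of_embedding (ModuleCat.of A A) (ModuleCat.of A ((i : Fin n) → S.proj (q i)))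
    (inferInstanceAs (Module.Injective A ((i : Fin n) → S.proj (q i)))) 
    (Module.Projective.of_equiv (DFinsupp.linearEquivFunOnFintype (R := A))) f ?_
  rw [← LinearMap.ker_eq_bot, eq_bot_iff]
  intro (x : A) (hx : f x = 0)
  have hx' : ∀ i, x * S.e (q i) i = 0 := fun i => congrArg Subtype.val (congrFun hx i)
  change x = 0
  rw [← S.sum_coef x]
  refine Finset.sum_eq_zero fun i _ => Finset.sum_eq_zero fun k _ => ?_
  by_cases h0 : S.e i k = 0
  · rw [h0, smul_zero]
  have hik := S.le_of_e_ne_zero h0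
  have hk : k ≤ j i := not_lt.mp fun h1 => h0 (hij i k h1)
  -- The path q → k is part of q → j, so it is nonzero and its coefficient in x e_{q i} is that of i
  -- → k in x.
  have := congrArg (S.coef (q i) k) (hx' i)
  rw [S.mul_e (hqi i), map_sum, Finset.sum_eq_single k, map_smul,
    S.coef_e_self (S.e_ne_zero_of_le ((hqi i).trans hik) hk (hqj i)), map_zero, smul_eq_mul,
    mul_one] at this
  · rw [this, zero_smul]
  · intro l _ hl
    rw [map_smul, S.coef_e_of_ne (by simp [hl]), smul_zero]
  · simp

/-! ### Shrinking support of cosyzygies and the upper bound -/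

/-- The algebra is not self-injective if there is a nonzero path of positive length into a
sink. -/
theorem not_injective {a b : Fin n} (hab : a < b) (hb : ∀ j, j ≤ b) (hbb : S.e b b ≠ 0)
    (h : S.e a b ≠ 0) : ¬ Module.Injective A A := by
  intro hA
  have hsum : ∀ x ∈ S.proj b, x = S.coef b b x • S.e b b := fun x hx => by
    nth_rw 1 [S.eq_sum_of_mem_proj hx]
    refine Finset.sum_eq_single b (fun k _ hk => ?_) (by simp)
    rw [S.e_eq_zero (lt_of_le_of_ne (hb k) hk), smul_zero]
  -- Since b is a sink, A e_b is the line K e_b, and right multiplication by a → b embeds it in A.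
  -- An extension g of the inclusion would give e_b = (a → b) g(1), where e_b has coefficient zero.
  obtain ⟨g, hg⟩ := hA.out ((LinearMap.toSpanSingleton A A (S.e a b)) ∘ₗ (S.proj b).subtype) (by
    rw [← LinearMap.ker_eq_bot, eq_bot_iff]
    rintro ⟨x, hx⟩ (hxa : x * S.e a b = 0)
    rw [hsum x hx, smul_mul_assoc, S.e_mul_e hab.le le_rfl] at hxa
    refine Subtype.ext ?_
    change x = 0
    rw [hsum x hx, (smul_eq_zero.mp hxa).resolve_right h, zero_smul]) (S.proj b).subtype
  have h1 : g (S.e b b * S.e a b) = S.e b b := hg ⟨S.e b b, S.e_mem_proj b b⟩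
  rw [S.e_mul_e hab.le le_rfl, ← mul_one (S.e a b), ← smul_eq_mul, map_smul, smul_eq_mul] at h1
  have h2 := S.coef_e_mul_of_lt (b := b) hab (g 1)
  rw [h1, S.coef_e_self hbb] at h2
  exact one_ne_zero h2

/-- If an essential submodule is killed by the vertices after `t`, then it contains everything that
is supported at the vertices from `t` on. -/
theorem e_smul_mem_of_essential {M : Type*} [AddCommGroup M] [Module A M] {N : Submodule A M}
    (hN : N.IsEssential) (t : ℕ) (hsupp : ∀ v : Fin n, t < v → ∀ x ∈ N, S.e v v • x = 0) (v : Fin n)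
    (hv : t ≤ v) (x : M) : S.e v v • x ∈ N := by
  induction v using WellFoundedGT.induction generalizing x with
  | ind v ih =>
  -- Downward induction: e_w M lies in N, which e_w kills. So paths leaving v act as zero on e_v x,
  -- whose span is a line; essentiality puts it in N.
  have hkill : ∀ w > v, ∀ y : M, S.e w w • y = 0 := fun w hw y => by
    have hv' : t < w := lt_of_le_of_lt hv hw
    have := hsupp w hv' _ (ih w hw hv'.le y)
    rwa [smul_smul, S.e_mul_e le_rfl le_rfl] at this
  by_cases hz : S.e v v • x = 0
  · rw [hz]; exact N.zero_mem
  obtain ⟨a, ha, ha0⟩ := N.isEssential_iff.mp hN _ hz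
  have hscalar : a • S.e v v • x = (algebraMap K A (S.coef v v a)) • S.e v v • x := by
    rw [smul_smul, S.mul_e le_rfl, Finset.sum_smul, Finset.sum_eq_single v, Algebra.smul_def,
      mul_smul]
    · intro w _ hw
      rcases lt_or_gt_of_ne hw with hw | hw
      · rw [S.e_eq_zero hw, smul_zero, zero_smul]
      · rw [← S.e_mul_e hw.le le_rfl, ← mul_smul_comm, mul_smul, hkill w hw]
    · simp
  have hc : S.coef v v a ≠ 0 := fun hc => ha0 (by rw [hscalar, hc, map_zero, zero_smul])
  have := N.smul_mem (algebraMap K A (S.coef v v a)⁻¹) ha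
  rwa [hscalar, smul_smul, ← map_mul, inv_mul_cancel₀ hc, map_one, one_smul] at this

/-- The `j`-th cosyzygy in a minimal injective resolution is not supported at the last `j`
vertices. -/
theorem e_smul_d_eq_zero {M : Type u} [AddCommGroup M] [Module A M]
    (R : MinimalInjectiveResolution A M) (j : ℕ) (v : Fin n) (hv : n ≤ v + j + 1) (x : R.I j) :
    S.e v v • R.d j x = 0 := by
  rw [← map_smul]
  induction j generalizing v with
  | zero =>
    -- Here v is the last vertex, so the support condition is vacuous.
    refine (R.exact_zero _).mpr (S.e_smul_mem_of_essential R.essential_zero v ?_ v le_rfl x)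
    intro w hw
    omega
  | succ j ih =>
    refine (R.exact_succ j _).mpr (S.e_smul_mem_of_essential (R.essential_succ j) v ?_ v le_rfl x)
    rintro w hw _ ⟨y, rfl⟩
    rw [← map_smul, ih w (by omega)]

/-- The dominant dimension is less than the number of vertices if the algebra is not
self-injective. -/
theorem lt_of_domDimGE (hn : 0 < n) (hA : ¬ Module.Injective A A) {k : ℕ} (h : DomDimGE A A k) :
    k < n := by
  by_contra! hk
  obtain ⟨R, hR⟩ := h
  refine hA (R.injective_of_d_eq_zero (n - 1) (fun j hj => hR j (by omega)) ?_)
  ext x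
  rw [← one_smul A (R.d (n - 1) x), S.one_eq, Finset.sum_smul]
  exact Finset.sum_eq_zero fun v _ => S.e_smul_d_eq_zero R _ v (by omega) x

end LinearPathSystem

/-! ### Paths of the linear quiver -/

namespace LinearQuiver

variable {n : ℕ}

theorem pos_injective : Function.Injective (pos : LinearQuiver n → ℕ) := Fin.val_injective

theorem pos_le_of_path {i j : LinearQuiver n} (p : Quiver.Path i j) : pos i ≤ pos j := by
  induction p with
  | nil => exact le_rfl
  | cons _ α ih => exact ih.trans (by have := α.down; omega)

theorem path_subsingleton {i j : LinearQuiver n} (p q : Quiver.Path i j) : p = q := by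
  induction p with
  | nil =>
    cases q with
    | nil => rfl
    | cons q α => have := pos_le_of_path q; have := α.down; omega
  | @cons b c p α ih =>
    cases q with
    | nil => have := pos_le_of_path p; have := α.down; omega
    | @cons b' _ q β =>
      have hα := α.down
      have hβ := β.down
      obtain rfl : b = b' := pos_injective (by omega)
      rw [ih q, show α = β from PLift.down_injective (Subsingleton.elim α.down β.down)]

theorem nonempty_path {i j : LinearQuiver n} (h : pos i ≤ pos j) : Nonempty (Quiver.Path i j) := by
  obtain ⟨d, hd⟩ := Nat.exists_eq_add_of_le h
  induction d generalizing j with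
  | zero =>
    obtain rfl : j = i := pos_injective hd
    exact ⟨.nil⟩
  | succ d ih =>
    have hj : pos j < n := Fin.isLt (n := n) j
    let k : LinearQuiver n := (⟨pos i + d, by omega⟩ : Fin n)
    have hk : pos k = pos i + d := rfl
    obtain ⟨p⟩ := ih (j := k) (by omega) hk
    exact ⟨p.cons ⟨by omega⟩⟩

end LinearQuiver

/-! ### Coefficients in the path algebra -/

namespace PathAlgebra

open LinearQuiver

variable (K : Type u) [Field K] {n : ℕ}

open Classical in
/-- The path from `i` to `j` in the path algebra of the linearly oriented quiver, or zero if there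
is none. -/
noncomputable def linearPath (i j : LinearQuiver n) : PathAlgebra K (LinearQuiver n) :=
  if h : Nonempty (Quiver.Path i j) then ofPath K ⟨i, j, h.some⟩ else 0

/-- The coefficient of the path from `i` to `j`. -/
noncomputable def linearCoef (i j : LinearQuiver n) : PathAlgebra K (LinearQuiver n) →ₗ[K] K :=
  (pathBasis K).constr K fun p => if p.1 = i ∧ p.2.1 = j then 1 else 0

variable {K}

theorem linearPath_eq {i j : LinearQuiver n} (p : Quiver.Path i j) :
    linearPath K i j = ofPath K ⟨i, j, p⟩ := by
  have h : Nonempty (Quiver.Path i j) := ⟨p⟩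
  rw [linearPath, dif_pos h, path_subsingleton p h.some]

theorem linearPath_eq_zero {i j : LinearQuiver n} (h : pos j < pos i) : linearPath K i j = 0 :=
  dif_neg fun ⟨p⟩ => (pos_le_of_path p).not_gt h

theorem linearPath_mul {i j k : LinearQuiver n} (hij : pos i ≤ pos j) (hjk : pos j ≤ pos k) :
    linearPath K j k * linearPath K i j = linearPath K i k := by
  obtain ⟨p⟩ := nonempty_path hij
  obtain ⟨q⟩ := nonempty_path hjk
  rw [linearPath_eq p, linearPath_eq q, linearPath_eq (p.comp q), ofPath_mul_ofPath_comp]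

theorem linearPath_mul_of_ne {i j j' k : LinearQuiver n} (h : j ≠ j') :
    linearPath K j' k * linearPath K i j = 0 := by
  rw [linearPath, linearPath]
  split_ifs
  · exact ofPath_mul_ofPath_of_ne _ _ h
  all_goals simp

theorem linearCoef_ofPath (i j : LinearQuiver n) (p : QuiverPath (LinearQuiver n)) :
    linearCoef K i j (ofPath K p) = if p.1 = i ∧ p.2.1 = j then 1 else 0 := by
  rw [← pathBasis_apply, linearCoef, Module.Basis.constr_basis]

theorem linearCoef_linearPath_self {i j : LinearQuiver n} (h : pos i ≤ pos j) :
    linearCoef K i j (linearPath K i j) = 1 := by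
  obtain ⟨p⟩ := nonempty_path h
  rw [linearPath_eq p, linearCoef_ofPath, if_pos ⟨rfl, rfl⟩]

theorem linearCoef_linearPath_of_ne {i j k l : LinearQuiver n} (h : (k, l) ≠ (i, j)) :
    linearCoef K i j (linearPath K k l) = 0 := by
  rw [linearPath]
  split_ifs
  · rw [linearCoef_ofPath, if_neg]
    rintro ⟨rfl, rfl⟩
    exact h rfl
  · exact map_zero _

theorem sum_linearCoef (x : PathAlgebra K (LinearQuiver n)) :
    ∑ i, ∑ j, linearCoef K i j x • linearPath K i j = x := by
  induction x using induction_paths with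
  | h0 => simp
  | hadd x y hx hy =>
    simp only [map_add, add_smul, Finset.sum_add_distrib, hx, hy]
  | hsmul r x hx => simp only [map_smul, smul_assoc, ← Finset.smul_sum, hx]
  | hpath a b p =>
    simp only [linearCoef_ofPath]
    rw [Finset.sum_eq_single a, Finset.sum_eq_single b]
    · rw [if_pos ⟨rfl, rfl⟩, one_smul, linearPath_eq p]
    · intro j _ hj
      rw [if_neg (fun h => hj h.2.symm), zero_smul]
    · simp
    · intro i _ hi
      exact Finset.sum_eq_zero fun j _ => by rw [if_neg (fun h => hi h.1.symm), zero_smul]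
    · simp

theorem one_eq_sum_linearPath : (1 : PathAlgebra K (LinearQuiver n)) = ∑ i, linearPath K i i := by
  rw [one_def]
  exact Finset.sum_congr rfl fun i _ => (linearPath_eq _).symm

theorem linearPath_mul_mul (i j : LinearQuiver n) (x : PathAlgebra K (LinearQuiver n)) :
    linearPath K j j * x * linearPath K i i = linearCoef K i j x • linearPath K i j := by
  induction x using induction_paths with
  | h0 => simp
  | hadd x y hx hy => rw [mul_add, add_mul, hx, hy, map_add, add_smul]
  | hsmul r x hx => rw [mul_smul_comm, smul_mul_assoc, hx, map_smul, smul_assoc]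
  | hpath a b p =>
    have hp := pos_le_of_path p
    rw [linearCoef_ofPath, ← linearPath_eq p]
    by_cases hb : b = j
    · subst hb
      rw [linearPath_mul hp le_rfl]
      by_cases ha : a = i
      · subst ha
        rw [linearPath_mul le_rfl hp, if_pos ⟨rfl, rfl⟩, one_smul]
      · rw [linearPath_mul_of_ne (Ne.symm ha), if_neg (fun h => ha h.1), zero_smul]
    · rw [linearPath_mul_of_ne hb, zero_mul, if_neg (fun h => hb h.2), zero_smul]

/-- Two-sided ideals are monomial: cutting by trivial paths on both sides leaves an invertible
multiple of the path. -/
theorem linearPath_mem {I : Ideal (PathAlgebra K (LinearQuiver n))} [I.IsTwoSided]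
    {x : PathAlgebra K (LinearQuiver n)} (hx : x ∈ I) {i j : LinearQuiver n}
    (h : linearCoef K i j x ≠ 0) : linearPath K i j ∈ I := by
  have h1 : linearCoef K i j x • linearPath K i j ∈ I := by
    rw [← linearPath_mul_mul]
    exact I.mul_mem_right _ (I.mul_mem_left _ hx)
  have h2 := (I.restrictScalars K).smul_mem (linearCoef K i j x)⁻¹ h1
  rwa [smul_smul, inv_mul_cancel₀ h, one_smul] at h2

/-- With at most one path between two vertices, coefficients multiply like matrix entries. -/
theorem linearCoef_mul (i k : LinearQuiver n) (x y : PathAlgebra K (LinearQuiver n)) :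
    linearCoef K i k (x * y) = ∑ j, linearCoef K j k x * linearCoef K i j y := by
  induction x using induction_paths with
  | h0 => simp
  | hadd x x' hx hx' => simp only [add_mul, map_add, hx, hx', Finset.sum_add_distrib]
  | hsmul r x hx =>
    simp only [smul_mul_assoc, map_smul, hx, smul_eq_mul, Finset.mul_sum, mul_assoc]
  | hpath c d p =>
  induction y using induction_paths with
  | h0 => simp
  | hadd x x' hx hx' => simp only [mul_add, map_add, hx, hx', Finset.sum_add_distrib]
  | hsmul r x hx =>
    simp only [mul_smul_comm, map_smul, hx, smul_eq_mul, Finset.mul_sum, mul_left_comm]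
  | hpath a b q =>
    rw [Finset.sum_eq_single c]
    · by_cases hbc : b = c
      · subst hbc
        rw [ofPath_mul_ofPath_comp]
        simp only [linearCoef_ofPath, true_and, and_true]
        split_ifs <;> simp_all
      · rw [ofPath_mul_ofPath_of_ne _ _ hbc, map_zero, linearCoef_ofPath i c,
          if_neg (fun h => hbc h.2), mul_zero]
    · intro j _ hj
      rw [linearCoef_ofPath j k, if_neg (fun h => hj h.1.symm), zero_mul]
    · simp

theorem linearCoef_eq_zero {i j : LinearQuiver n} (h : pos j < pos i)
    (x : PathAlgebra K (LinearQuiver n)) : linearCoef K i j x = 0 := by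
  induction x using induction_paths with
  | h0 => simp
  | hadd x y hx hy => rw [map_add, hx, hy, add_zero]
  | hsmul r x hx => rw [map_smul, hx, smul_zero]
  | hpath a b p =>
    rw [linearCoef_ofPath, if_neg]
    rintro ⟨rfl, rfl⟩
    exact (pos_le_of_path p).not_gt h

theorem linearCoef_mul_eq_zero {m l : ℕ} {x y : PathAlgebra K (LinearQuiver n)}
    (hx : ∀ i j : LinearQuiver n, pos j < pos i + m → linearCoef K i j x = 0)
    (hy : ∀ i j : LinearQuiver n, pos j < pos i + l → linearCoef K i j y = 0)
    (i k : LinearQuiver n) (hik : pos k < pos i + (m + l)) : linearCoef K i k (x * y) = 0 := by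
  rw [linearCoef_mul]
  refine Finset.sum_eq_zero fun j _ => ?_
  rcases lt_or_ge (pos j) (pos i + l) with h | h
  · rw [hy i j h, mul_zero]
  · rw [hx j k (by omega), zero_mul]

/-! ### Path length and admissibility -/

variable (K n) in
/-- The left ideal spanned by the paths of length at least `m`. -/
noncomputable def lengthIdeal (m : ℕ) : Ideal (PathAlgebra K (LinearQuiver n)) where
  carrier := {x | ∀ i j : LinearQuiver n, pos j < pos i + m → linearCoef K i j x = 0}
  zero_mem' i j _ := map_zero _
  add_mem' hx hy i j h := by rw [map_add, hx i j h, hy i j h, add_zero]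
  smul_mem' c x hx i j h :=
    -- Every element is supported in length at least 0.
    linearCoef_mul_eq_zero (m := 0) (l := m) (fun i j h => linearCoef_eq_zero h c) hx i j
      (by omega)

theorem arrowIdeal_le_lengthIdeal :
    arrowIdeal K (LinearQuiver n) ≤ lengthIdeal K n 1 := by
  intro x hx
  induction hx using TwoSidedIdeal.span_induction with
  | mem x hx =>
    obtain ⟨a, b, α, rfl⟩ := hx
    intro i j hij
    rw [linearCoef_ofPath, if_neg]
    rintro ⟨rfl, rfl⟩
    have : pos a + 1 = pos b := α.down
    change pos b < pos a + 1 at hij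
    omega
  | zero => exact zero_mem _
  | add x y _ _ hx hy => exact add_mem hx hy
  | neg x _ hx => exact neg_mem hx
  | left_absorb a x _ hx => exact (lengthIdeal K n 1).mul_mem_left a hx
  | right_absorb b x _ hx =>
    exact fun i j h => linearCoef_mul_eq_zero (m := 1) (l := 0) hx
      (fun i j h => linearCoef_eq_zero h b) i j (by omega)

theorem arrowIdeal_sq_le_lengthIdeal :
    arrowIdeal K (LinearQuiver n) ^ 2 ≤ lengthIdeal K n 2 := by
  rw [Submodule.pow_succ, Submodule.pow_one, Ideal.mul_le]
  exact fun x hx y hy => linearCoef_mul_eq_zero (m := 1) (l := 1)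
    (arrowIdeal_le_lengthIdeal hx) (arrowIdeal_le_lengthIdeal hy)

theorem IsAdmissible.linearPath_notMem {I : Ideal (PathAlgebra K (LinearQuiver n))}
    (hI : IsAdmissible I) {i j : LinearQuiver n} (hij : pos i ≤ pos j) (h : pos j < pos i + 2) :
    linearPath K i j ∉ I := fun hmem => by
  have := arrowIdeal_sq_le_lengthIdeal (hI.le_sq hmem) i j h
  rw [linearCoef_linearPath_self hij] at this
  exact one_ne_zero this

/-! ### The path basis of the quotient -/

open Classical in
/-- The coefficient of the path from `i` to `j` in a quotient of the path algebra. -/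
noncomputable def quotientCoef (I : Ideal (PathAlgebra K (LinearQuiver n))) [I.IsTwoSided]
    (i j : LinearQuiver n) : (PathAlgebra K (LinearQuiver n) ⧸ I) →ₗ[K] K :=
  -- For a path outside I the coefficient vanishes on I, by monomiality, and descends; otherwise 0
  -- is the default.
  if h : linearPath K i j ∈ I then 0 else
    (I.restrictScalars K).liftQ (linearCoef K i j)
      (fun _ hx => by_contra fun h0 => h (linearPath_mem (I := I) hx h0)) ∘ₗ
      (Submodule.Quotient.restrictScalarsEquiv K I).symm.toLinearMap

theorem quotientCoef_eq_zero {I : Ideal (PathAlgebra K (LinearQuiver n))} [I.IsTwoSided]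
    {i j : LinearQuiver n} (h : linearPath K i j ∈ I) : quotientCoef I i j = 0 :=
  dif_pos h

theorem quotientCoef_mk {I : Ideal (PathAlgebra K (LinearQuiver n))} [I.IsTwoSided]
    {i j : LinearQuiver n} (h : linearPath K i j ∉ I) (x : PathAlgebra K (LinearQuiver n)) :
    quotientCoef I i j (Ideal.Quotient.mk I x) = linearCoef K i j x := by
  rw [quotientCoef, dif_neg h]
  rfl

/-- The residue classes of the paths in a quotient of the path algebra of the linearly oriented
quiver. -/
noncomputable def quotientPathSystem (I : Ideal (PathAlgebra K (LinearQuiver n))) [I.IsTwoSided] :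
    LinearPathSystem K (PathAlgebra K (LinearQuiver n) ⧸ I) n where
  e (i j : LinearQuiver n) := Ideal.Quotient.mk I (linearPath K i j)
  coef (i j : LinearQuiver n) := quotientCoef I i j
  sum_coef x := by
    obtain ⟨x, rfl⟩ := Ideal.Quotient.mk_surjective x
    conv_rhs => rw [← sum_linearCoef x, map_sum]
    refine Finset.sum_congr rfl fun (i : LinearQuiver n) _ => ?_
    rw [map_sum]
    refine Finset.sum_congr rfl fun (j : LinearQuiver n) _ => ?_
    have hsmul : ∀ c : K, Ideal.Quotient.mk I (c • linearPath K i j) =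
      c • Ideal.Quotient.mk I (linearPath K i j) := fun c => rfl
    rw [hsmul]
    by_cases h : linearPath K i j ∈ I
    · rw [Ideal.Quotient.eq_zero_iff_mem.mpr h, smul_zero, smul_zero]
    · rw [quotientCoef_mk h]
  one_eq := by
    rw [← map_one (Ideal.Quotient.mk I), one_eq_sum_linearPath, map_sum]
    rfl
  e_mul_e {i j k} hij hjk := by
    rw [← map_mul]
    exact congrArg _ (linearPath_mul hij hjk)
  e_mul_e_of_ne {i j j' k} h := by
    rw [← map_mul, ← map_zero (Ideal.Quotient.mk I)]
    exact congrArg _ (linearPath_mul_of_ne h)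
  e_eq_zero {i j} h := by
    rw [linearPath_eq_zero h, map_zero]
  coef_e_self {i j} h := by
    have h' : linearPath K (n := n) i j ∉ I := fun hmem =>
      h (Ideal.Quotient.eq_zero_iff_mem.mpr hmem)
    rw [quotientCoef_mk h']
    refine linearCoef_linearPath_self (not_lt.mp fun hlt => h' ?_)
    rw [linearPath_eq_zero hlt]
    exact I.zero_mem
  coef_e_of_ne {i j k l} h := by
    by_cases h' : linearPath K (n := n) i j ∈ I
    · rw [quotientCoef_eq_zero h', LinearMap.zero_apply]
    · rw [quotientCoef_mk h', linearCoef_linearPath_of_ne h]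

theorem IsAdmissible.quotientPathSystem_e_ne_zero {I : Ideal (PathAlgebra K (LinearQuiver n))}
    [I.IsTwoSided] (hI : IsAdmissible I) {i j : Fin n} (hij : i ≤ j) (h : (j : ℕ) < i + 2) :
    (quotientPathSystem I).e i j ≠ 0 := fun h0 =>
  hI.linearPath_notMem (i := i) (j := j) hij h (Ideal.Quotient.eq_zero_iff_mem.mp h0)

end PathAlgebra

theorem mainTheorem2 {K : Type*} [Field K] (n : ℕ) (hn : 3 ≤ n)
    (I : Ideal (PathAlgebra K (LinearQuiver n))) [I.IsTwoSided]
    (hI : PathAlgebra.IsAdmissible I) :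
    1 ≤ domDim (PathAlgebra K (LinearQuiver n) ⧸ I) ∧
      domDim (PathAlgebra K (LinearQuiver n) ⧸ I) ≤ ((n - 1 : ℕ) : ℕ∞) := by
  let S := PathAlgebra.quotientPathSystem I
  constructor
  · have h1 := S.domDimGE_one fun i => hI.quotientPathSystem_e_ne_zero le_rfl (by omega)
    exact le_iSup₂_of_le (f := fun (k : ℕ) (_ : DomDimGE _ _ k) => (k : ℕ∞)) 1 h1 (by simp)
  -- The last arrow has length 1, so it survives in the quotient.
  · have hA := S.not_injective (a := ⟨n - 2, by omega⟩) (b := ⟨n - 1, by omega⟩)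
      (Fin.mk_lt_mk.mpr (by omega)) (fun j => Fin.mk_le_mk.mpr (by omega))
      (hI.quotientPathSystem_e_ne_zero le_rfl (by omega))
      (hI.quotientPathSystem_e_ne_zero (Fin.mk_le_mk.mpr (by omega)) (by simp only; omega))
    refine iSup₂_le fun k hk => ?_
    have := S.lt_of_domDimGE (by omega) hA hk
    exact_mod_cast (by omega : k ≤ n - 1)
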